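/- Let $1\le K\le d$ and let $\Sigma\in\mathbb{R}^{d\times d}$ be a real symmetric matrix with unit eigenvectors $u_1^*,\dots,u_d^*$ for eigenvalues $1=\lambda_1^*>\lambda_2^*>\dots>\lambda_d^*>0$, and put $\lambda_{d+1}^*=0$. Let $\mathcal T_i=\lambda_i^*-\lambda_{i+1}^*$ for $i\in[d]$ (so $\mathcal T_d=\lambda_d^*$), $\mathcal T_{K,\min}=\min_{i\in[K]}\mathcal T_i$. Fix $t\in\mathbb{N}$ and unit vectors $x_{0,1},\dots,x_{0,K}\in\mathbb{R}^d$. Run the deflation method with $t$ steps of power iteration: $\Sigma_1=\Sigma$; for $k=1,\dots,K$, $v_k$ is the vector $x_t$ obtained from $x_0=x_{0,k}$ by $x_{s+1}=\Sigma_kx_s/\|\Sigma_kx_s\|_2$, and $$\Sigma_{k+1}=\Sigma_k-v_kv_k^\top\Sigma_kv_kv_k^\top .$$ Let $u_k$ be a unit eigenvector for the largest eigenvalue of $\Sigma_k$, with the sign chosen such that $u_k^\top u_k^*\ge 0$, and let $\delta_k=v_k-u_k$. Assume that $c_0\in(0,\infty)$ satisfies $|x_{0,k}^\top u_k|>c_0^{-1}$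 for all $k\in[K]$, and let $\mathcal G_k=1+\frac{c_0\lambda_k^*\lambda_{k+1}^*}{\lambda_k^*-\lambda_{k+1}^*}$. Suppose that $$t\ \ge\ \log(2\mathcal G_k)\Big(\log\frac{\lambda_{k'+1}^*+7\lambda_{k'}^*}{\lambda_{k'}^*+7\lambda_{k'+1}^*}\Big)^{-1}\quad\text{for all } k\in[K],\ k'\in[k-1],$$ $$t\ \ge\ \frac{1}{\log\lambda_k^*-\log\lambda_{k+1}^*}\quad\text{for all } k\in[d-1],$$ $$\sum_{k'=1}^{K-1}8^{K-k'}\frac{\lambda_{k'}^*}{\mathcal T_{k'}}\Big(\frac{7\lambda_{k'+1}^*+\lambda_{k'}^*}{7\lambda_{k'}^*+\lambda_{k'+1}^*}\Big)^t\ \le\ \frac{\mathcal T_{K,\min}}{140\,c_0}.$$ Then for all $k\in[K]$ $$\|v_k-u_k^*\|_2\ \le\ 3\sum_{k'=1}^{k}8^{k-k'}\frac{\lambda_{k'}^*}{\lambda_k^*}\Big(5\|\delta_{k'}\|_2+\frac{7c_0}{\mathcal T_{k'}}\Big(\frac{\lambda_{k'+1}^*}{\lambda_{k'}^*}\Big)^t\Big).$$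 -/

import Mathlib

namespace InexactDeflation

noncomputable section

/-! Indices are shifted by one throughout: the index `k : ℕ` (starting at `0`) stands for the
`(k+1)`-st eigenvalue, eigenvector or deflation step. -/

/-- The standing assumption on the matrix `S`: it is real symmetric, with unit eigenvectors
`ustar i` for eigenvalues `lam i`, and `1 = lam 0 > lam 1 > ... > lam (d-1) > 0`. -/
structure SpectralAssumption {d : ℕ} (S : Matrix (Fin d) (Fin d) ℝ) (lam : Fin d → ℝ)
    (ustar : Fin d → EuclideanSpace ℝ (Fin d)) : Prop where
  symm : S.IsSymm
  eigen : ∀ i, Matrix.toEuclideanLin S (ustar i) = lam i • ustar i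
  unit : ∀ i, ‖ustar i‖ = 1
  anti : StrictAnti lam
  pos : ∀ i, 0 < lam i
  top : ∀ h : 0 < d, lam ⟨0, h⟩ = 1

/-- The eigenvalues as a sequence indexed by `ℕ`, continued by `0` after the last one. -/
def eig {d : ℕ} (lam : Fin d → ℝ) (k : ℕ) : ℝ :=
  if h : k < d then lam ⟨k, h⟩ else 0

/-- The eigengaps: the difference of consecutive eigenvalues, and the last eigenvalue itself
at the last index. -/
def gap {d : ℕ} (lam : Fin d → ℝ) (k : ℕ) : ℝ :=
  eig lam k - eig lam (k + 1)

/-- The smallest of the first `K` eigengaps. -/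
def minGap {d : ℕ} (lam : Fin d → ℝ) (K : ℕ) (hK : 1 ≤ K) : ℝ :=
  (Finset.range K).inf' (Finset.nonempty_range_iff.mpr (Nat.one_le_iff_ne_zero.mp hK)) (gap lam)

/-- The quantity `1 + c₀ λ_k λ_{k+1} / (λ_k - λ_{k+1})`. -/
def growth {d : ℕ} (c₀ : ℝ) (lam : Fin d → ℝ) (k : ℕ) : ℝ :=
  1 + c₀ * eig lam k * eig lam (k + 1) / (eig lam k - eig lam (k + 1))

/-- `u` is a normalized top eigenvector of `M`: a unit eigenvector for the largest eigenvalue. -/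
def IsTopEigenvector {d : ℕ} (M : Matrix (Fin d) (Fin d) ℝ)
    (u : EuclideanSpace ℝ (Fin d)) : Prop :=
  ‖u‖ = 1 ∧ ∃ μ : ℝ, Matrix.toEuclideanLin M u = μ • u ∧
    ∀ ν : ℝ, Module.End.HasEigenvalue (Matrix.toEuclideanLin M) ν → ν ≤ μ

/-- `t` steps of power iteration on `M` started at `x`: multiply by `M`, then normalize. -/
def powerIteration {d : ℕ} (M : Matrix (Fin d) (Fin d) ℝ) (x : EuclideanSpace ℝ (Fin d)) :
    ℕ → EuclideanSpace ℝ (Fin d)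
  | 0 => x
  | t + 1 => ‖Matrix.toEuclideanLin M (powerIteration M x t)‖⁻¹ •
      Matrix.toEuclideanLin M (powerIteration M x t)

/-- The matrix `v vᵀ`. -/
def outer {d : ℕ} (v : EuclideanSpace ℝ (Fin d)) : Matrix (Fin d) (Fin d) ℝ :=
  Matrix.vecMulVec v.ofLp v.ofLp

/-- The deflated matrices: `S` at first; at step `k`, with `v` the output of `t` steps of power
iteration on the current matrix `M` started at `x₀ k`, the next matrix is `M - v vᵀ M v vᵀ`. -/
def deflMat {d : ℕ} (S : Matrix (Fin d) (Fin d) ℝ) (x₀ : ℕ → EuclideanSpace ℝ (Fin d)) (t : ℕ) :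
    ℕ → Matrix (Fin d) (Fin d) ℝ
  | 0 => S
  | k + 1 => deflMat S x₀ t k -
      outer (powerIteration (deflMat S x₀ t k) (x₀ k) t) * deflMat S x₀ t k *
        outer (powerIteration (deflMat S x₀ t k) (x₀ k) t)

/-- The approximate eigenvectors returned by the deflation method with `t` steps of power
iteration. -/
def deflVec {d : ℕ} (S : Matrix (Fin d) (Fin d) ℝ) (x₀ : ℕ → EuclideanSpace ℝ (Fin d)) (t : ℕ)
    (k : ℕ) : EuclideanSpace ℝ (Fin d) :=
  powerIteration (deflMat S x₀ t k) (x₀ k) t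

end

end InexactDeflation

open InexactDeflation

/-! Let `Y` be the sum of the earlier errors `λ_j ‖v_j - u_j‖`, each multiplied by 8 at every later
step. By induction the deflated operator stays within `5 * Y` of the operator from which the true
eigenvectors `e_j` have been removed, and the third hypothesis on `t` keeps `560 * Y` below the
current eigengap.

The crux is `λ_k ‖u_k - e_k‖ ≤ 8 * Y`, with no eigengap in the denominator
(`EigenSystem.mul_norm_top_sub_le`). The component of `u_k` along the earlier `e_j` costs only `5 *
Y / σ`, because exact deflation maps into their orthogonal complement. The component beyond `e_k` is
quadratic in `Y`, and one factor `Y` absorbs the gap. The next deflation error then obeys the same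
bound (`EigenSystem.closeDefl_succ`), and the power iteration contracts at a rate that keeps the
budget valid (`DeflationInvariant.succ`).

Power iteration may approach `-u_k`. If some `‖v_j - u_j‖ ≥ 1`, the right-hand side exceeds 2 and
there is nothing to prove; otherwise the induction gives the bound with room to spare. -/

namespace InexactDeflation

/-! ### Perturbation of eigenvalues and eigenvectors under deflation -/

section Abstract

variable {E : Type*} [NormedAddCommGroup E] [InnerProductSpace ℝ E]

/-- A symmetric operator with an orthonormal family of eigenvectors `e i`, `i < d`, whose norm on
the orthogonal complement of the first `m` eigenvectors is at most the eigenvalue `lam m`. -/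
structure EigenSystem (S : E →ₗ[ℝ] E) (d : ℕ) (lam : ℕ → ℝ) (e : ℕ → E) : Prop where
  unit : ∀ i < d, ‖e i‖ = 1
  orth : ∀ i < d, ∀ j < d, i ≠ j → inner ℝ (e i) (e j) = 0
  eigen : ∀ i < d, S (e i) = lam i • e i
  symm : S.IsSymmetric
  contract : ∀ m ≤ d, ∀ x, (∀ i < m, inner ℝ (e i) x = 0) → ‖S x‖ ≤ lam m * ‖x‖
  nonneg : ∀ i, 0 ≤ lam i

/-- The projection of `x` to the span of `e 0, ..., e (k-1)`, for orthonormal `e`. -/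
noncomputable def partialProj (e : ℕ → E) (k : ℕ) (x : E) : E :=
  ∑ j ∈ Finset.range k, inner ℝ (e j) x • e j

/-- The operator `S` with its first `k` eigenvectors deflated exactly. -/
noncomputable def exactDefl (S : E →ₗ[ℝ] E) (e : ℕ → E) (k : ℕ) (x : E) : E :=
  S (x - partialProj e k x)

theorem partialProj_succ (e : ℕ → E) (k : ℕ) (x : E) :
    partialProj e (k + 1) x = partialProj e k x + inner ℝ (e k) x • e k :=
  Finset.sum_range_succ _ _

namespace EigenSystem

variable {S : E →ₗ[ℝ] E} {d : ℕ} {lam : ℕ → ℝ} {e : ℕ → E}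

theorem inner_partialProj_of_lt (h : EigenSystem S d lam e) {i k : ℕ} (hi : i < k) (hk : k ≤ d)
    (x : E) : inner ℝ (e i) (partialProj e k x) = inner ℝ (e i) x := by
  rw [partialProj, inner_sum, Finset.sum_eq_single i]
  · rw [inner_smul_right, real_inner_self_eq_norm_sq, h.unit i (by omega)]; ring
  · intro j hj hji
    rw [inner_smul_right, h.orth i (by omega) j (by have := Finset.mem_range.mp hj; omega) hji.symm,
      mul_zero]
  · intro hi'; exact absurd (Finset.mem_range.mpr hi) hi'

theorem inner_sub_partialProj (h : EigenSystem S d lam e) {i k : ℕ} (hi : i < k) (hk : k ≤ d)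
    (x : E) : inner ℝ (e i) (x - partialProj e k x) = 0 := by
  rw [inner_sub_right, h.inner_partialProj_of_lt hi hk, sub_self]

theorem inner_partialProj_left_eq_zero {k : ℕ} {x y : E} (hy : ∀ i < k, inner ℝ (e i) y = 0) :
    inner ℝ (partialProj e k x) y = 0 := by
  rw [partialProj, sum_inner]
  refine Finset.sum_eq_zero fun j hj => ?_
  rw [real_inner_smul_left, hy j (Finset.mem_range.mp hj), mul_zero]

theorem norm_sq_eq_partialProj (h : EigenSystem S d lam e) {k : ℕ} (hk : k ≤ d) (x : E) :
    ‖x‖ ^ 2 = ‖partialProj e k x‖ ^ 2 + ‖x - partialProj e k x‖ ^ 2 := by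
  have h0 := inner_partialProj_left_eq_zero (x := x)
    fun i hi => h.inner_sub_partialProj (x := x) hi hk
  have := norm_add_sq_real (partialProj e k x) (x - partialProj e k x)
  rw [h0, add_sub_cancel] at this
  linarith

theorem norm_sub_partialProj_le (h : EigenSystem S d lam e) {k : ℕ} (hk : k ≤ d) (x : E) :
    ‖x - partialProj e k x‖ ≤ ‖x‖ := by
  have := h.norm_sq_eq_partialProj hk x
  refine (pow_le_pow_iff_left₀ (norm_nonneg _) (norm_nonneg _) two_ne_zero).mp ?_
  nlinarith [sq_nonneg ‖partialProj e k x‖]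

theorem inner_map (h : EigenSystem S d lam e) {i : ℕ} (hi : i < d) (x : E) :
    inner ℝ (e i) (S x) = lam i * inner ℝ (e i) x := by
  rw [← h.symm, h.eigen i hi, real_inner_smul_left]

theorem norm_exactDefl_le (h : EigenSystem S d lam e) {k : ℕ} (hk : k ≤ d) (x : E) :
    ‖exactDefl S e k x‖ ≤ lam k * ‖x‖ :=
  (h.contract k hk _ fun _ hi => h.inner_sub_partialProj hi hk x).trans
    (mul_le_mul_of_nonneg_left (h.norm_sub_partialProj_le hk x) (h.nonneg k))

theorem inner_exactDefl (h : EigenSystem S d lam e) {i k : ℕ} (hi : i < k) (hk : k ≤ d) (x : E) :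
    inner ℝ (e i) (exactDefl S e k x) = 0 := by
  rw [exactDefl, h.inner_map (by omega), h.inner_sub_partialProj hi hk, mul_zero]

theorem exactDefl_self (h : EigenSystem S d lam e) {k : ℕ} (hk : k < d) :
    exactDefl S e k (e k) = lam k • e k := by
  have : partialProj e k (e k) = 0 := by
    refine Finset.sum_eq_zero fun j hj => ?_
    have := Finset.mem_range.mp hj
    rw [h.orth j (by omega) k hk (by omega), zero_smul]
  rw [exactDefl, this, sub_zero, h.eigen k hk]

theorem exactDefl_succ (h : EigenSystem S d lam e) {k : ℕ} (hk : k < d) (x : E) :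
    exactDefl S e (k + 1) x = exactDefl S e k x - (lam k * inner ℝ (e k) x) • e k := by
  rw [exactDefl, partialProj_succ, ← sub_sub, map_sub, map_smul, h.eigen k hk, smul_smul,
    mul_comm, exactDefl]

/-- The operator `A` is within `ε` of the exactly deflated operator. -/
def _root_.InexactDeflation.CloseDefl (S : E →ₗ[ℝ] E) (e : ℕ → E) (k : ℕ) (A : E →ₗ[ℝ] E)
    (ε : ℝ) : Prop :=
  ∀ x, ‖A x - exactDefl S e k x‖ ≤ ε * ‖x‖

theorem norm_map_le (h : EigenSystem S d lam e) {k : ℕ} (hk : k ≤ d) {A : E →ₗ[ℝ] E} {ε : ℝ}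
    (hA : CloseDefl S e k A ε) (x : E) : ‖A x‖ ≤ (lam k + ε) * ‖x‖ := by
  have h1 := h.norm_exactDefl_le hk x
  have h2 := hA x
  have h3 := norm_add_le (exactDefl S e k x) (A x - exactDefl S e k x)
  rw [add_sub_cancel] at h3
  linarith

/-- Weyl's inequality for the top eigenvalue: test the Rayleigh quotient at `e k` for the lower
bound, and use the operator norm at `u` for the upper one. -/
theorem abs_sub_eigenvalue_le (h : EigenSystem S d lam e) {k : ℕ} (hk : k < d) {A : E →ₗ[ℝ] E}
    {ε σ : ℝ} {u : E} (hA : CloseDefl S e k A ε) (hu : ‖u‖ = 1) (hσ : A u = σ • u)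
    (hray : ∀ x, inner ℝ x (A x) ≤ σ * ‖x‖ ^ 2) : |σ - lam k| ≤ ε := by
  rw [abs_le]
  constructor
  · have h1 := hray (e k)
    have h2 : -(ε) ≤ inner ℝ (e k) (A (e k) - exactDefl S e k (e k)) := by
      have h3 := abs_real_inner_le_norm (e k) (A (e k) - exactDefl S e k (e k))
      have h4 := hA (e k)
      rw [h.unit k hk] at h3 h4
      have := neg_le_of_abs_le h3
      linarith
    rw [inner_sub_right, h.exactDefl_self hk, inner_smul_right, real_inner_self_eq_norm_sq,
      h.unit k hk] at h2
    rw [h.unit k hk] at h1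
    linarith
  · have h1 := h.norm_map_le hk.le hA u
    rw [hσ, norm_smul, hu, Real.norm_eq_abs] at h1
    have := le_abs_self σ
    linarith

/-- Exact deflation has range orthogonal to the deflated directions, so pairing `A u = σ u` with the
projection leaves only the perturbation. The divisor is `σ`, not an eigengap. -/
theorem mul_norm_partialProj_le (h : EigenSystem S d lam e) {k : ℕ} (hk : k ≤ d) {A : E →ₗ[ℝ] E}
    {ε σ : ℝ} {u : E} (hA : CloseDefl S e k A ε) (hu : ‖u‖ = 1) (hσ : A u = σ • u) (hε : 0 ≤ ε) :
    σ * ‖partialProj e k u‖ ≤ ε := by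
  set q := partialProj e k u with hq
  have h1 : inner ℝ q u = ‖q‖ ^ 2 := by
    have h0 := inner_partialProj_left_eq_zero (x := u)
      fun i hi => h.inner_sub_partialProj (x := u) hi hk
    rw [← hq, inner_sub_right, real_inner_self_eq_norm_sq] at h0
    linarith
  have h2 : inner ℝ q (exactDefl S e k u) = 0 :=
    inner_partialProj_left_eq_zero fun i hi => h.inner_exactDefl hi hk u
  have h3 := (le_abs_self _).trans (abs_real_inner_le_norm q (A u - exactDefl S e k u))
  have h4 := hA u
  rw [inner_sub_right, h2, hσ, inner_smul_right, h1, sub_zero] at h3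
  rw [hσ, hu, mul_one] at h4
  rcases (norm_nonneg q).eq_or_lt with h5 | h5
  · rw [← h5, mul_zero]; exact hε
  · have h6 := h3.trans (mul_le_mul_of_nonneg_left h4 h5.le)
    refine le_of_mul_le_mul_left ?_ h5
    linarith

/-- Pair `A u = σ u` with the tail `p` of `u`. As `p` is orthogonal to each `e j`, the vector `v j`
enters only through `v j - e j`. The other factor `inner ℝ (v j) u` is small as well, which makes
the bound second order. -/
theorem mul_norm_sub_partialProj_le (h : EigenSystem S d lam e) {k : ℕ} (hk : k < d)
    {A : E →ₗ[ℝ] E} {σ : ℝ} {u : E} {μ : ℕ → ℝ} {v : ℕ → E}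
    (hA : ∀ x, A x = S x - ∑ j ∈ Finset.range k, (μ j * inner ℝ (v j) x) • v j)
    (hσ : A u = σ • u) :
    (σ - lam (k + 1)) * ‖u - partialProj e (k + 1) u‖ ≤
      ∑ j ∈ Finset.range k, |μ j| * |inner ℝ (v j) u| * ‖v j - e j‖ := by
  set p := u - partialProj e (k + 1) u with hp
  have hpe : ∀ i < k + 1, inner ℝ (e i) p = 0 := fun i hi => h.inner_sub_partialProj hi hk u
  have hpu : inner ℝ p u = ‖p‖ ^ 2 := by
    have h0 := inner_partialProj_left_eq_zero (x := u) hpe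
    have h1 : u = p + partialProj e (k + 1) u := by rw [hp]; abel
    calc inner ℝ p u = inner ℝ p (p + partialProj e (k + 1) u) := by rw [← h1]
      _ = _ := by rw [inner_add_right, real_inner_self_eq_norm_sq, real_inner_comm, h0, add_zero]
  have hpS : inner ℝ p (S u) ≤ lam (k + 1) * ‖p‖ ^ 2 := by
    have h1 : inner ℝ p (S (partialProj e (k + 1) u)) = 0 := by
      rw [← h.symm, real_inner_comm]
      refine inner_partialProj_left_eq_zero fun i hi => ?_
      rw [h.inner_map (by omega), hpe i hi, mul_zero]
    have h2 : S u = S p + S (partialProj e (k + 1) u) := by rw [hp, ← map_add, sub_add_cancel]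
    rw [h2, inner_add_right, h1, add_zero]
    have h3 := (le_abs_self _).trans (abs_real_inner_le_norm p (S p))
    have h4 := mul_le_mul_of_nonneg_left (h.contract (k + 1) hk p hpe) (norm_nonneg p)
    nlinarith
  have hmain : (σ - lam (k + 1)) * ‖p‖ ^ 2 ≤
      (∑ j ∈ Finset.range k, |μ j| * |inner ℝ (v j) u| * ‖v j - e j‖) * ‖p‖ := by
    have h1 : σ * ‖p‖ ^ 2 = inner ℝ p (S u) -
        ∑ j ∈ Finset.range k, μ j * inner ℝ (v j) u * inner ℝ p (v j) := by
      rw [← hpu, ← inner_smul_right, ← hσ, hA, inner_sub_right, inner_sum]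
      simp only [inner_smul_right]
    have h2 : -∑ j ∈ Finset.range k, μ j * inner ℝ (v j) u * inner ℝ p (v j) ≤
        (∑ j ∈ Finset.range k, |μ j| * |inner ℝ (v j) u| * ‖v j - e j‖) * ‖p‖ := by
      rw [← Finset.sum_neg_distrib, Finset.sum_mul]
      refine Finset.sum_le_sum fun j hj => ?_
      have hj := Finset.mem_range.mp hj
      have h3 : inner ℝ p (v j) = inner ℝ p (v j - e j) := by
        rw [inner_sub_right, real_inner_comm (e j) p, hpe j (by omega), sub_zero]
      refine (neg_le_abs _).trans ?_
      rw [h3, abs_mul, abs_mul, mul_assoc _ ‖v j - e j‖]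
      refine mul_le_mul_of_nonneg_left ?_ (by positivity)
      rw [mul_comm]
      exact abs_real_inner_le_norm _ _
    linarith
  rcases (norm_nonneg p).eq_or_lt with h5 | h5
  · rw [← h5, mul_zero]; positivity
  · refine le_of_mul_le_mul_right ?_ h5
    linarith

/-- A unit vector with nonnegative component along `e k` is close to `e k` if its other
components are small. -/
theorem norm_sub_le_of_inner_nonneg (h : EigenSystem S d lam e) {k : ℕ} (hk : k < d) {u : E}
    (hu : ‖u‖ = 1) (hpos : 0 ≤ inner ℝ u (e k)) :
    ‖u - e k‖ ≤ 3 / 2 * (‖partialProj e k u‖ + ‖u - partialProj e (k + 1) u‖) := by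
  set a := ‖partialProj e k u‖
  set b := ‖u - partialProj e (k + 1) u‖
  set c := inner ℝ u (e k)
  have h1 : ‖u - e k‖ ^ 2 = 2 - 2 * c := by
    rw [norm_sub_sq_real, hu, h.unit k hk]; ring
  have h2 : ‖partialProj e (k + 1) u‖ ^ 2 = a ^ 2 + c ^ 2 := by
    rw [partialProj_succ, norm_add_sq_real, inner_partialProj_left_eq_zero, norm_smul,
      h.unit k hk, Real.norm_eq_abs, mul_one, sq_abs, real_inner_comm]
    · ring
    · intro i hi
      rw [inner_smul_right, h.orth i (by omega) k hk (by omega), mul_zero]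
  have h3 := h.norm_sq_eq_partialProj (k := k + 1) hk u
  rw [hu, h2] at h3
  have ha : 0 ≤ a := norm_nonneg _
  have hb : 0 ≤ b := norm_nonneg _
  have hc : c ≤ 1 := by
    have := (le_abs_self _).trans (abs_real_inner_le_norm u (e k))
    rwa [hu, h.unit k hk, one_mul] at this
  -- For `0 ≤ c ≤ 1`, `2 - 2 * c ≤ 2 * (1 - c ^ 2) = 2 * (a ^ 2 + b ^ 2)`, and `2 ≤ 9 / 4`.
  refine (pow_le_pow_iff_left₀ (norm_nonneg _) (by positivity) two_ne_zero).mp ?_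
  have : 1 = a ^ 2 + c ^ 2 + b ^ 2 := by linarith
  nlinarith [mul_nonneg ha hb, mul_nonneg hpos (sub_nonneg.mpr hc)]

end EigenSystem

end Abstract

/-! ### One step: power iteration and the new deflation error -/

section Step

variable {E : Type*} [NormedAddCommGroup E] [InnerProductSpace ℝ E]

/-- The tangent of the angle between the iterates of the power iteration and the top eigenvector
decays geometrically. -/
theorem tangent_powerIteration_le {A : E →ₗ[ℝ] E} (hsymm : A.IsSymmetric) {σ τ c : ℝ} {u : E}
    (hu : ‖u‖ = 1) (hσ : A u = σ • u) (hσ0 : 0 < σ) (hτ0 : 0 ≤ τ) (hc : 0 < c)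
    (hτ : ∀ x, inner ℝ u x = 0 → ‖A x‖ ≤ τ * ‖x‖) {x : ℕ → E} (hx0 : ‖x 0‖ = 1)
    (hinit : c⁻¹ < |inner ℝ (x 0) u|) (hx : ∀ s, x (s + 1) = ‖A (x s)‖⁻¹ • A (x s)) (s : ℕ) :
    ‖x s‖ = 1 ∧ inner ℝ u (x s) ≠ 0 ∧
      ‖x s - inner ℝ u (x s) • u‖ ≤ c * (τ / σ) ^ s * |inner ℝ u (x s)| := by
  have horth : ∀ y, inner ℝ u (y - inner ℝ u y • u) = 0 := fun y => by
    rw [inner_sub_right, inner_smul_right, real_inner_self_eq_norm_sq, hu]; ring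
  induction s with
  | zero =>
    rw [real_inner_comm] at hinit
    have hpos : 0 < |inner ℝ u (x 0)| := (inv_pos.mpr hc).trans hinit
    refine ⟨hx0, abs_pos.mp hpos, ?_⟩
    have h1 : ‖x 0 - inner ℝ u (x 0) • u‖ ≤ 1 := by
      have h2 := norm_add_sq_real (x 0 - inner ℝ u (x 0) • u) (inner ℝ u (x 0) • u)
      rw [sub_add_cancel, hx0, inner_smul_right, real_inner_comm u (x 0 - _), horth] at h2
      refine (pow_le_pow_iff_left₀ (norm_nonneg _) zero_le_one two_ne_zero).mp ?_
      nlinarith [sq_nonneg ‖inner ℝ u (x 0) • u‖]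
    rw [pow_zero, mul_one]
    have h3 := (inv_lt_iff_one_lt_mul₀ hc).mp hinit
    linarith
  | succ s ih =>
    obtain ⟨-, hne, hle⟩ := ih
    have hin : inner ℝ u (A (x s)) = σ * inner ℝ u (x s) := by
      rw [← hsymm, hσ, real_inner_smul_left]
    have hA : A (x s) ≠ 0 := by
      intro h0
      rw [h0, inner_zero_right] at hin
      exact mul_ne_zero hσ0.ne' hne hin.symm
    have hN : 0 < ‖A (x s)‖ := norm_pos_iff.mpr hA
    rw [hx, inner_smul_right, hin]
    refine ⟨?_, by positivity, ?_⟩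
    · rw [norm_smul, norm_inv, norm_norm, inv_mul_cancel₀ hN.ne']
    · have h1 : ‖A (x s)‖⁻¹ • A (x s) - (‖A (x s)‖⁻¹ * (σ * inner ℝ u (x s))) • u =
          ‖A (x s)‖⁻¹ • A (x s - inner ℝ u (x s) • u) := by
        rw [map_sub, map_smul, hσ]
        module
      rw [h1, norm_smul, norm_inv, norm_norm, abs_mul, abs_mul, abs_of_pos (inv_pos.mpr hN),
        abs_of_pos hσ0]
      have h2 := (hτ _ (horth (x s))).trans (mul_le_mul_of_nonneg_left hle hτ0)
      have h3 : τ * (c * (τ / σ) ^ s * |inner ℝ u (x s)|) =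
          c * (τ / σ) ^ (s + 1) * (σ * |inner ℝ u (x s)|) := by
        rw [pow_succ]
        field_simp
      rw [h3] at h2
      calc ‖A (x s)‖⁻¹ * ‖A (x s - inner ℝ u (x s) • u)‖
          ≤ ‖A (x s)‖⁻¹ * (c * (τ / σ) ^ (s + 1) * (σ * |inner ℝ u (x s)|)) :=
            mul_le_mul_of_nonneg_left h2 (inv_pos.mpr hN).le
        _ = _ := by ring

/-- Two unit vectors at distance less than one are as close as the tangent of their angle. -/
theorem norm_sub_le_of_tangent_le {u v : E} (hu : ‖u‖ = 1) (hv : ‖v‖ = 1) (hlt : ‖v - u‖ < 1)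
    {B : ℝ} (hB : 0 ≤ B) (htan : ‖v - inner ℝ u v • u‖ ≤ B * |inner ℝ u v|) :
    ‖v - u‖ ≤ 2 * B := by
  set c := inner ℝ u v with hc
  have h1 : ‖v - u‖ ^ 2 = 2 - 2 * c := by
    rw [norm_sub_sq_real, hu, hv, real_inner_comm]; ring
  have h2 : ‖v - c • u‖ ^ 2 = 1 - c ^ 2 := by
    rw [norm_sub_sq_real, hv, inner_smul_right, norm_smul, hu, Real.norm_eq_abs, mul_one, sq_abs,
      real_inner_comm, ← hc]
    ring
  have hc1 : c ≤ 1 := by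
    have := (le_abs_self _).trans (abs_real_inner_le_norm u v)
    rwa [hu, hv, one_mul] at this
  -- Distance below one excludes `v` near `-u`, which the tangent alone cannot detect.
  have hc0 : 0 < c := by nlinarith [norm_nonneg (v - u)]
  rw [abs_of_pos hc0] at htan
  have h3 : B * c ≤ B := by nlinarith
  have h4 : ‖v - c • u‖ ^ 2 ≤ B ^ 2 := pow_le_pow_left₀ (norm_nonneg _) (htan.trans h3) 2
  refine (pow_le_pow_iff_left₀ (norm_nonneg _) (by positivity) two_ne_zero).mp ?_
  nlinarith

namespace EigenSystem

variable {S : E →ₗ[ℝ] E} {d : ℕ} {lam : ℕ → ℝ} {e : ℕ → E} {k : ℕ} {A : E →ₗ[ℝ] E} {Y σ : ℝ}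
  {u : E}

/-- The top eigenvector of the inexactly deflated operator, compared with `e k`. -/
theorem mul_norm_top_sub_le (h : EigenSystem S d lam e) (hanti : Antitone lam) (hk : k < d)
    {μ : ℕ → ℝ} {v : ℕ → E} (hY : 0 ≤ Y) (hgap : 560 * Y ≤ lam k - lam (k + 1))
    (hgap0 : 0 < lam k - lam (k + 1))
    (hA : CloseDefl S e k A (5 * Y))
    (hA' : ∀ x, A x = S x - ∑ j ∈ Finset.range k, (μ j * inner ℝ (v j) x) • v j)
    (hμ : ∀ j < k, |μ j| ≤ 2 * lam j)
    (hsum : ∑ j ∈ Finset.range k, lam j * ‖v j - e j‖ ≤ 2 * Y)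
    (hu : ‖u‖ = 1) (hσ : A u = σ • u) (hray : ∀ x, inner ℝ x (A x) ≤ σ * ‖x‖ ^ 2)
    (hpos : 0 ≤ inner ℝ u (e k)) : lam k * ‖u - e k‖ ≤ 8 * Y := by
  have hlk := h.nonneg (k + 1)
  have hσk := abs_le.mp (h.abs_sub_eigenvalue_le hk hA hu hσ hray)
  have hq := h.mul_norm_partialProj_le hk.le hA hu hσ (by positivity)
  have hp := h.mul_norm_sub_partialProj_le hk hA' hσ
  have hclose := h.norm_sub_le_of_inner_nonneg hk hu hpos
  set a := ‖partialProj e k u‖ with ha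
  set b := ‖u - partialProj e (k + 1) u‖
  have ha0 : 0 ≤ a := norm_nonneg _
  have hb0 : 0 ≤ b := norm_nonneg _
  set T := lam k - lam (k + 1) with hT
  -- Since `5 * Y ≤ T / 112 ≤ lam k / 112`, replacing `σ` by `lam k` costs a factor `112 / 111`.
  have hqa : lam k * a ≤ 5.1 * Y := by
    have h1 : lam k * (111 / 112) ≤ σ := by linarith
    nlinarith [mul_le_mul_of_nonneg_right h1 ha0]
  have hterm : ∀ j < k, lam k * (|μ j| * |inner ℝ (v j) u| * ‖v j - e j‖) ≤
      (2 * (lam j * ‖v j - e j‖)) * (7.1 * Y) := by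
    intro j hj
    have h1 : lam k * ‖v j - e j‖ ≤ 2 * Y := by
      refine le_trans ?_ hsum
      refine (mul_le_mul_of_nonneg_right (hanti hj.le) (norm_nonneg _)).trans ?_
      exact Finset.single_le_sum (f := fun j => lam j * ‖v j - e j‖)
        (fun i _ => mul_nonneg (h.nonneg i) (norm_nonneg _)) (Finset.mem_range.mpr hj)
    have h2 : |inner ℝ (v j) u| ≤ ‖v j - e j‖ + a := by
      have h3 : inner ℝ (v j) u = inner ℝ (v j - e j) u + inner ℝ (e j) (partialProj e k u) := by
        rw [h.inner_partialProj_of_lt hj hk.le, ← inner_add_left, sub_add_cancel]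
      have h4 := abs_real_inner_le_norm (v j - e j) u
      have h5 := abs_real_inner_le_norm (e j) (partialProj e k u)
      rw [hu, mul_one] at h4
      rw [h.unit j (by omega), one_mul] at h5
      rw [h3]
      exact (abs_add_le _ _).trans (add_le_add h4 h5)
    have h3 : lam k * |inner ℝ (v j) u| ≤ 7.1 * Y := by
      have := mul_le_mul_of_nonneg_left h2 (h.nonneg k)
      linarith
    calc lam k * (|μ j| * |inner ℝ (v j) u| * ‖v j - e j‖)
        = (|μ j| * ‖v j - e j‖) * (lam k * |inner ℝ (v j) u|) := by ring
      _ ≤ (|μ j| * ‖v j - e j‖) * (7.1 * Y) := mul_le_mul_of_nonneg_left h3 (by positivity)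
      _ ≤ (2 * lam j * ‖v j - e j‖) * (7.1 * Y) := by
          refine mul_le_mul_of_nonneg_right ?_ (by positivity)
          exact mul_le_mul_of_nonneg_right (hμ j hj) (norm_nonneg _)
      _ = _ := by ring
  -- The tail is at most `28.4 * Y ^ 2` over nearly `T`; `Y ≤ T / 560` cancels the gap. The total `3
  -- / 2 * (5.1 + 0.06)` stays below 8.
  have hpb : lam k * b ≤ 0.06 * Y := by
    have h1 : lam k * ∑ j ∈ Finset.range k, |μ j| * |inner ℝ (v j) u| * ‖v j - e j‖ ≤
        (2 * (2 * Y)) * (7.1 * Y) := by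
      rw [Finset.mul_sum]
      refine (Finset.sum_le_sum fun j hj => hterm j (Finset.mem_range.mp hj)).trans ?_
      rw [← Finset.sum_mul, ← Finset.mul_sum]
      exact mul_le_mul_of_nonneg_right (by linarith) (by positivity)
    have h2 : lam k * ((σ - lam (k + 1)) * b) ≤ (2 * (2 * Y)) * (7.1 * Y) :=
      (mul_le_mul_of_nonneg_left hp (h.nonneg k)).trans h1
    have h3 : 111 / 112 * T ≤ σ - lam (k + 1) := by linarith
    have h4 : (111 / 112 * T) * (lam k * b) ≤ (σ - lam (k + 1)) * (lam k * b) :=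
      mul_le_mul_of_nonneg_right h3 (mul_nonneg (h.nonneg k) hb0)
    have h5 : 28.4 * Y * Y ≤ 28.4 * Y * (T / 560) :=
      mul_le_mul_of_nonneg_left (by linarith) (by positivity)
    refine le_of_mul_le_mul_left ?_ hgap0
    nlinarith [mul_nonneg hgap0.le hY]
  have := mul_le_mul_of_nonneg_left hclose (h.nonneg k)
  linarith

/-- The operator norm of the inexactly deflated operator on the orthogonal complement of its
top eigenvector. -/
theorem norm_map_le_of_orthogonal (h : EigenSystem S d lam e) (hk : k < d)
    (hA : CloseDefl S e k A (5 * Y)) (hclose : lam k * ‖u - e k‖ ≤ 8 * Y) {x : E}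
    (hx : inner ℝ u x = 0) : ‖A x‖ ≤ (lam (k + 1) + 13 * Y) * ‖x‖ := by
  have h1 := hA x
  have h2 := h.norm_exactDefl_le (k := k + 1) hk x
  have h3 : exactDefl S e k x =
      exactDefl S e (k + 1) x + (lam k * inner ℝ (e k) x) • e k := by
    rw [h.exactDefl_succ hk, sub_add_cancel]
  -- Orthogonality to `u` makes the component along `e k` an error term; it adds `8 * Y` to the `5 *
  -- Y` of closeness.
  have h4 : |inner ℝ (e k) x| ≤ ‖u - e k‖ * ‖x‖ := by
    have : inner ℝ (e k) x = - inner ℝ (u - e k) x := by rw [inner_sub_left, hx]; ring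
    rw [this, abs_neg]
    exact abs_real_inner_le_norm _ _
  have h5 : ‖(lam k * inner ℝ (e k) x) • e k‖ ≤ 8 * Y * ‖x‖ := by
    rw [norm_smul, h.unit k hk, mul_one, Real.norm_eq_abs, abs_mul, abs_of_nonneg (h.nonneg k)]
    have := mul_le_mul_of_nonneg_left h4 (h.nonneg k)
    have := mul_le_mul_of_nonneg_right hclose (norm_nonneg x)
    linarith
  have h6 := norm_add_le (exactDefl S e (k + 1) x) ((lam k * inner ℝ (e k) x) • e k)
  have h7 := norm_add_le (exactDefl S e k x) (A x - exactDefl S e k x)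
  rw [add_sub_cancel] at h7
  rw [← h3] at h6
  linarith

/-- The error of one deflation step with the inexact eigenvector `v`. -/
theorem closeDefl_succ (h : EigenSystem S d lam e) (hk : k < d) (hsymm : A.IsSymmetric)
    {v : E} (hY : 0 ≤ Y) (hgap : 560 * Y ≤ lam k)
    (hA : CloseDefl S e k A (5 * Y)) (hu : ‖u‖ = 1) (hv : ‖v‖ = 1) (hσ : A u = σ • u)
    (hray : ∀ x, inner ℝ x (A x) ≤ σ * ‖x‖ ^ 2) (hclose : lam k * ‖u - e k‖ ≤ 8 * Y)
    {A' : E →ₗ[ℝ] E} (hA' : ∀ x, A' x = A x - (inner ℝ v (A v) * inner ℝ v x) • v) :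
    CloseDefl S e (k + 1) A' (5 * (8 * Y + lam k * ‖v - u‖)) := by
  intro x
  have hσk := abs_le.mp (h.abs_sub_eigenvalue_le hk hA hu hσ hray)
  set m := inner ℝ v (A v) with hm
  have hlk := h.nonneg k
  have hve : lam k * ‖v - e k‖ ≤ lam k * ‖v - u‖ + 8 * Y := by
    have := norm_sub_le_norm_sub_add_norm_sub v u (e k)
    have := mul_le_mul_of_nonneg_left this hlk
    linarith
  have hmσ : |m - σ| ≤ 3 * (lam k * ‖v - u‖) := by
    have h1 : m - σ = inner ℝ (v - u) (A v) + σ * inner ℝ u (v - u) := by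
      rw [inner_sub_left, inner_sub_right, real_inner_self_eq_norm_sq, hu, ← hsymm u v, hσ,
        real_inner_smul_left]
      ring
    have h2 := abs_real_inner_le_norm (v - u) (A v)
    have h3 := abs_real_inner_le_norm u (v - u)
    have h4 := h.norm_map_le hk.le hA v
    rw [hv, mul_one] at h4
    rw [hu, one_mul] at h3
    have hσ0 : 0 ≤ σ := by linarith
    have h5 := mul_le_mul_of_nonneg_left h4 (norm_nonneg (v - u))
    have h6 := mul_le_mul_of_nonneg_left h3 hσ0
    have h7 : σ * ‖v - u‖ ≤ (lam k + 5 * Y) * ‖v - u‖ :=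
      mul_le_mul_of_nonneg_right (by linarith) (norm_nonneg _)
    have h8 : (560 * Y) * ‖v - u‖ ≤ lam k * ‖v - u‖ :=
      mul_le_mul_of_nonneg_right hgap (norm_nonneg _)
    have h9 := abs_add_le (inner ℝ (v - u) (A v)) (σ * inner ℝ u (v - u))
    rw [abs_mul, abs_of_nonneg hσ0] at h9
    rw [h1]
    nlinarith [mul_nonneg hlk (norm_nonneg (v - u))]
  have hmk : |m - lam k| ≤ 3 * (lam k * ‖v - u‖) + 5 * Y := by
    have := abs_sub_le m σ (lam k)
    have := abs_le.mpr hσk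
    linarith
  -- Telescoping from `m v vᵀ` to `lam k e eᵀ`, one factor at a time. With `D = lam k * ‖v - u‖` the
  -- four terms cost `5Y`, `3D + 5Y` and twice `D + 8Y`, in total `5D + 26Y ≤ 5 * (8Y + D)`.
  have hdecomp : A' x - exactDefl S e (k + 1) x = (A x - exactDefl S e k x) -
      ((m - lam k) * inner ℝ v x) • v - (lam k * inner ℝ (v - e k) x) • v -
      (lam k * inner ℝ (e k) x) • (v - e k) := by
    rw [hA', h.exactDefl_succ hk, inner_sub_left]
    module
  have b1 := hA x
  have b2 : ‖((m - lam k) * inner ℝ v x) • v‖ ≤ (3 * (lam k * ‖v - u‖) + 5 * Y) * ‖x‖ := by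
    rw [norm_smul, hv, mul_one, Real.norm_eq_abs, abs_mul]
    have := abs_real_inner_le_norm v x
    rw [hv, one_mul] at this
    exact mul_le_mul hmk this (abs_nonneg _) (by positivity)
  have b3 : ‖(lam k * inner ℝ (v - e k) x) • v‖ ≤ (lam k * ‖v - e k‖) * ‖x‖ := by
    rw [norm_smul, hv, mul_one, Real.norm_eq_abs, abs_mul, abs_of_nonneg hlk, mul_assoc]
    exact mul_le_mul_of_nonneg_left (abs_real_inner_le_norm _ _) hlk
  have b4 : ‖(lam k * inner ℝ (e k) x) • (v - e k)‖ ≤ (lam k * ‖v - e k‖) * ‖x‖ := by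
    rw [norm_smul, Real.norm_eq_abs, abs_mul, abs_of_nonneg hlk]
    have := abs_real_inner_le_norm (e k) x
    rw [h.unit k hk, one_mul] at this
    have := mul_le_mul_of_nonneg_left this (mul_nonneg hlk (norm_nonneg (v - e k)))
    linarith
  have b5 := mul_le_mul_of_nonneg_right hve (norm_nonneg x)
  rw [hdecomp]
  refine (norm_sub_le _ _).trans ?_
  have c1 := norm_sub_le (A x - exactDefl S e k x - ((m - lam k) * inner ℝ v x) • v)
    ((lam k * inner ℝ (v - e k) x) • v)
  have c2 := norm_sub_le (A x - exactDefl S e k x) (((m - lam k) * inner ℝ v x) • v)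
  have : 0 ≤ Y * ‖x‖ := by positivity
  have : 0 ≤ lam k * ‖v - u‖ * ‖x‖ := by positivity
  nlinarith

end EigenSystem

end Step

/-! ### Induction over the deflation steps -/

section Run

/-- The accumulated error of the first `m` steps, with weights growing by the factor `8`. -/
noncomputable def errAccum (w : ℕ → ℝ) (m : ℕ) : ℝ :=
  ∑ j ∈ Finset.range m, (8 : ℝ) ^ (m - 1 - j) * w j

theorem errAccum_succ (w : ℕ → ℝ) (m : ℕ) : errAccum w (m + 1) = 8 * errAccum w m + w m := by
  rw [errAccum, Finset.sum_range_succ, errAccum, Finset.mul_sum]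
  congr 1
  · refine Finset.sum_congr rfl fun j hj => ?_
    have := Finset.mem_range.mp hj
    rw [← mul_assoc, ← pow_succ']
    congr 2
    omega
  · simp

theorem errAccum_nonneg {w : ℕ → ℝ} (hw : ∀ j, 0 ≤ w j) (m : ℕ) : 0 ≤ errAccum w m :=
  Finset.sum_nonneg fun j _ => mul_nonneg (by positivity) (hw j)

/-- As `m < K`, the budget's weights exceed those of `errAccum` by at least a factor 8, and gaps of
at most 1 give `lam j ≤ lam j / gap`. Hence `8 * Y ≤ 2 * c₀ * G / (140 * c₀) = G / 70`, which is
where 560 comes from. -/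
theorem errAccum_le_of_budget {K t : ℕ} {lam ρ δ : ℕ → ℝ} {c₀ G : ℝ} (hc₀ : 0 < c₀)
    (hlam : ∀ j, 0 ≤ lam j) (hgap : ∀ j < K, 0 < lam j - lam (j + 1))
    (hgap1 : ∀ j, lam j - lam (j + 1) ≤ 1) (hρ : ∀ j, 0 ≤ ρ j)
    (hbudget : ∑ j ∈ Finset.range (K - 1), (8 : ℝ) ^ (K - 1 - j) * (lam j / (lam j - lam (j + 1))) *
      ρ j ^ t ≤ G / (140 * c₀))
    {m : ℕ} (hm : m < K) (hδ : ∀ j < m, δ j ≤ 2 * (c₀ * ρ j ^ t)) :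
    560 * errAccum (fun j => lam j * δ j) m ≤ G := by
  have h1 : 8 * errAccum (fun j => lam j * δ j) m ≤ 2 * c₀ * ∑ j ∈ Finset.range (K - 1),
      (8 : ℝ) ^ (K - 1 - j) * (lam j / (lam j - lam (j + 1))) * ρ j ^ t := by
    rw [errAccum, Finset.mul_sum, Finset.mul_sum]
    calc ∑ j ∈ Finset.range m, 8 * ((8 : ℝ) ^ (m - 1 - j) * (lam j * δ j))
        ≤ ∑ j ∈ Finset.range m, 2 * c₀ *
          ((8 : ℝ) ^ (K - 1 - j) * (lam j / (lam j - lam (j + 1))) * ρ j ^ t) := by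
          refine Finset.sum_le_sum fun j hj => ?_
          have hj := Finset.mem_range.mp hj
          have h2 : lam j ≤ lam j / (lam j - lam (j + 1)) :=
            le_div_self (hlam j) (hgap j (by omega)) (hgap1 j)
          have h3 : lam j * δ j ≤ lam j / (lam j - lam (j + 1)) * (2 * (c₀ * ρ j ^ t)) :=
            (mul_le_mul_of_nonneg_left (hδ j hj) (hlam j)).trans
              (mul_le_mul_of_nonneg_right h2 (by have := pow_nonneg (hρ j) t; positivity))
          have h4 : (8 : ℝ) * 8 ^ (m - 1 - j) ≤ 8 ^ (K - 1 - j) := by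
            rw [← pow_succ']
            exact pow_le_pow_right₀ (by norm_num) (by omega)
          have h5 : 0 ≤ lam j / (lam j - lam (j + 1)) * (2 * (c₀ * ρ j ^ t)) :=
            mul_nonneg ((hlam j).trans h2) (by have := pow_nonneg (hρ j) t; positivity)
          calc 8 * ((8 : ℝ) ^ (m - 1 - j) * (lam j * δ j))
              = (8 * (8 : ℝ) ^ (m - 1 - j)) * (lam j * δ j) := by ring
            _ ≤ (8 * (8 : ℝ) ^ (m - 1 - j)) *
                (lam j / (lam j - lam (j + 1)) * (2 * (c₀ * ρ j ^ t))) :=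
                mul_le_mul_of_nonneg_left h3 (by positivity)
            _ ≤ 8 ^ (K - 1 - j) * (lam j / (lam j - lam (j + 1)) * (2 * (c₀ * ρ j ^ t))) :=
                mul_le_mul_of_nonneg_right h4 h5
            _ = _ := by ring
      _ ≤ _ := by
          refine Finset.sum_le_sum_of_subset_of_nonneg
            (Finset.range_subset_range.mpr (by omega)) fun j hj _ => ?_
          have hj := Finset.mem_range.mp hj
          have := pow_nonneg (hρ j) t
          have := div_nonneg (hlam j) (hgap j (by omega)).le
          positivity
  have h2 := h1.trans (mul_le_mul_of_nonneg_left hbudget (by positivity))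
  have h3 : 2 * c₀ * (G / (140 * c₀)) = G / 70 := by field_simp; ring
  linarith

variable {E : Type*} [NormedAddCommGroup E] [InnerProductSpace ℝ E]

/-- The data of an inexact deflation: the operators `A k`, their top eigenvectors `u k` with
eigenvalue `σ k`, and the unit vectors `v k` used to deflate. -/
structure DeflationRun (S : E →ₗ[ℝ] E) (e : ℕ → E) (K : ℕ) (A : ℕ → E →ₗ[ℝ] E) (u v : ℕ → E)
    (σ : ℕ → ℝ) : Prop where
  zero : A 0 = S
  succ : ∀ k x, A (k + 1) x = A k x - (inner ℝ (v k) (A k (v k)) * inner ℝ (v k) x) • v k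
  symm : ∀ k, (A k).IsSymmetric
  unit : ∀ k < K, ‖u k‖ = 1
  eigen : ∀ k < K, A k (u k) = σ k • u k
  top : ∀ k < K, ∀ x, inner ℝ x (A k x) ≤ σ k * ‖x‖ ^ 2
  sign : ∀ k < K, 0 ≤ inner ℝ (u k) (e k)

/-- The eigenvalue ratio governing the power iteration on the inexactly deflated operators. -/
noncomputable def rate (lam : ℕ → ℝ) (k : ℕ) : ℝ :=
  (7 * lam (k + 1) + lam k) / (7 * lam k + lam (k + 1))

/-- The error of the power iteration is at most its rate of convergence, unless it is large. -/
def FastOrFar (c₀ : ℝ) (t K : ℕ) (A : ℕ → E →ₗ[ℝ] E) (u v : ℕ → E)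
    (σ : ℕ → ℝ) : Prop :=
  ∀ k < K, ∀ τ, 0 < σ k → 0 ≤ τ → (∀ x, inner ℝ (u k) x = 0 → ‖A k x‖ ≤ τ * ‖x‖) →
    ‖v k‖ = 1 ∧ (‖v k - u k‖ < 1 → ‖v k - u k‖ ≤ 2 * (c₀ * (τ / σ k) ^ t))

variable {S : E →ₗ[ℝ] E} {d K t : ℕ} {lam : ℕ → ℝ} {e : ℕ → E} {A : ℕ → E →ₗ[ℝ] E} {u v : ℕ → E}
  {σ : ℕ → ℝ} {c₀ G : ℝ}

theorem DeflationRun.apply_eq (r : DeflationRun S e K A u v σ) (k : ℕ) (x : E) :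
    A k x = S x -
      ∑ j ∈ Finset.range k, (inner ℝ (v j) (A j (v j)) * inner ℝ (v j) x) • v j := by
  induction k with
  | zero => simp [r.zero]
  | succ k ih => rw [r.succ, ih, Finset.sum_range_succ, sub_sub]

/-- What is known after `m` steps of an inexact deflation. -/
structure DeflationInvariant (S : E →ₗ[ℝ] E) (lam : ℕ → ℝ) (e : ℕ → E) (A : ℕ → E →ₗ[ℝ] E)
    (u v : ℕ → E) (c₀ : ℝ) (t m : ℕ) : Prop where
  delta : ∀ j < m, ‖v j - u j‖ ≤ 2 * (c₀ * rate lam j ^ t)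
  close : CloseDefl S e m (A m) (5 * errAccum (fun j => lam j * ‖v j - u j‖) m)
  sum : ∑ j ∈ Finset.range m, lam j * ‖v j - e j‖ ≤
    2 * errAccum (fun j => lam j * ‖v j - u j‖) m
  rayleigh : ∀ j < m, |inner ℝ (v j) (A j (v j))| ≤ 2 * lam j

section

variable (h : EigenSystem S d lam e) (hanti : Antitone lam) (hKd : K ≤ d)
  (r : DeflationRun S e K A u v σ) (hc₀ : 0 < c₀)
  (hgap : ∀ j < K, 0 < lam j - lam (j + 1)) (hgap1 : ∀ j, lam j - lam (j + 1) ≤ 1)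
  (hG : ∀ j < K, G ≤ lam j - lam (j + 1))
  (hbudget : ∑ j ∈ Finset.range (K - 1), (8 : ℝ) ^ (K - 1 - j) * (lam j / (lam j - lam (j + 1))) *
      rate lam j ^ t ≤ G / (140 * c₀))

include h in
theorem rate_nonneg (j : ℕ) : 0 ≤ rate lam j := by
  have := h.nonneg j
  have := h.nonneg (j + 1)
  unfold rate
  positivity

include h hc₀ hgap hgap1 hG hbudget in
theorem DeflationInvariant.errAccum_le_gap {m : ℕ} (hm : m < K)
    (I : DeflationInvariant S lam e A u v c₀ t m) :
    560 * errAccum (fun j => lam j * ‖v j - u j‖) m ≤ lam m - lam (m + 1) :=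
  (errAccum_le_of_budget hc₀ h.nonneg hgap hgap1 (rate_nonneg h) hbudget hm I.delta).trans (hG m hm)

include h hanti hKd r hc₀ hgap hgap1 hG hbudget in
theorem DeflationInvariant.mul_norm_top_sub_le {m : ℕ} (hm : m < K)
    (I : DeflationInvariant S lam e A u v c₀ t m) :
    lam m * ‖u m - e m‖ ≤ 8 * errAccum (fun j => lam j * ‖v j - u j‖) m :=
  h.mul_norm_top_sub_le hanti (by omega)
    (errAccum_nonneg (fun j => mul_nonneg (h.nonneg j) (norm_nonneg _)) m)
    (I.errAccum_le_gap h hc₀ hgap hgap1 hG hbudget hm) (hgap m hm) I.close (r.apply_eq m)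
    I.rayleigh I.sum (r.unit m hm) (r.eigen m hm) (r.top m hm) (r.sign m hm)

include h hanti hKd r hc₀ hgap hgap1 hG hbudget in
theorem DeflationInvariant.succ (hpow : FastOrFar c₀ t K A u v σ) {m : ℕ} (hm : m < K)
    (hnear : ‖v m - u m‖ < 1) (I : DeflationInvariant S lam e A u v c₀ t m) :
    DeflationInvariant S lam e A u v c₀ t (m + 1) := by
  have hY := I.errAccum_le_gap h hc₀ hgap hgap1 hG hbudget hm
  have hue := I.mul_norm_top_sub_le h hanti hKd r hc₀ hgap hgap1 hG hbudget hm
  have hY0 := errAccum_nonneg (w := fun j => lam j * ‖v j - u j‖)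
    (fun j => mul_nonneg (h.nonneg j) (norm_nonneg _)) m
  have hclose := I.close
  have hsum := I.sum
  have hT := hgap m hm
  have hmd : m < d := by omega
  have hσ := abs_le.mp
    (h.abs_sub_eigenvalue_le hmd hclose (r.unit m hm) (r.eigen m hm) (r.top m hm))
  have hl1 := h.nonneg (m + 1)
  have hsucc := errAccum_succ (fun j => lam j * ‖v j - u j‖) m
  set Y := errAccum (fun j => lam j * ‖v j - u j‖) m
  have hσ0 : 0 < σ m := by linarith
  -- The contraction factor is available only now, since it rests on the invariant at `m`; hence the
  -- quantifier over `τ` in `FastOrFar`.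
  obtain ⟨hv, hδ⟩ := hpow m hm (lam (m + 1) + 13 * Y) hσ0 (by positivity)
    fun x hx => h.norm_map_le_of_orthogonal hmd hclose hue hx
  have hδ' := hδ hnear
  have hve : lam m * ‖v m - e m‖ ≤ lam m * ‖v m - u m‖ + 8 * Y := by
    have := norm_sub_le_norm_sub_add_norm_sub (v m) (u m) (e m)
    have := mul_le_mul_of_nonneg_left this (h.nonneg m)
    linarith
  have hD : 0 ≤ lam m * ‖v m - u m‖ := mul_nonneg (h.nonneg m) (norm_nonneg _)
  refine ⟨fun j hj => ?_, ?_, ?_, fun j hj => ?_⟩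
  · rcases Nat.lt_succ_iff_lt_or_eq.mp hj with hj | rfl
    · exact I.delta j hj
    · refine hδ'.trans ?_
      -- An eighth of the gap covers both the `13 * Y` in the numerator and the `5 * Y` lost in `σ
      -- j`.
      have h1 : (lam (j + 1) + 13 * Y) / σ j ≤ rate lam j := by
        rw [rate, div_le_div_iff₀ hσ0 (by linarith)]
        have h2 : 8 * (lam (j + 1) + 13 * Y) ≤ 7 * lam (j + 1) + lam j := by linarith
        have h3 : 7 * lam j + lam (j + 1) ≤ 8 * σ j := by linarith
        have h4 := mul_le_mul h2 h3 (by linarith) (by linarith)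
        linarith
      have h2 := pow_le_pow_left₀ (by positivity) h1 t
      have h3 := mul_le_mul_of_nonneg_left h2 hc₀.le
      linarith
  · rw [hsucc]
    exact h.closeDefl_succ hmd (r.symm m) hY0 (by linarith) hclose (r.unit m hm) hv (r.eigen m hm)
      (r.top m hm) hue (r.succ m)
  · rw [Finset.sum_range_succ, hsucc]
    linarith
  · rcases Nat.lt_succ_iff_lt_or_eq.mp hj with hj | rfl
    · exact I.rayleigh j hj
    · have h1 := abs_real_inner_le_norm (v j) (A j (v j))
      have h2 := h.norm_map_le hmd.le hclose (v j)
      rw [hv] at h1 h2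
      linarith

include h hanti hKd r hc₀ hgap hgap1 hG hbudget in
/-- The error bound for inexact deflation, as long as the power iterations do not end far from
the top eigenvectors. -/
theorem mul_norm_sub_le_errAccum (hpow : FastOrFar c₀ t K A u v σ) {k : ℕ} (hk : k < K)
    (hnear : ∀ j ≤ k, ‖v j - u j‖ < 1) :
    lam k * ‖v k - e k‖ ≤ errAccum (fun j => lam j * ‖v j - u j‖) (k + 1) := by
  have I : ∀ m ≤ k, DeflationInvariant S lam e A u v c₀ t m := by
    intro m
    induction m with
    | zero =>
      intro _
      refine ⟨by simp, fun x => ?_, by simp [errAccum], by simp⟩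
      simp [r.zero, exactDefl, partialProj, errAccum]
    | succ m ih =>
      intro hm
      exact (ih (by omega)).succ h hanti hKd r hc₀ hgap hgap1 hG hbudget hpow (by omega)
        (hnear m (by omega))
  have h1 := (I k le_rfl).mul_norm_top_sub_le h hanti hKd r hc₀ hgap hgap1 hG hbudget hk
  have h2 := mul_le_mul_of_nonneg_left
    (norm_sub_le_norm_sub_add_norm_sub (v k) (u k) (e k)) (h.nonneg k)
  rw [errAccum_succ]
  linarith

end

end Run

theorem inner_map_le_of_eigenvalues_le {E : Type*} [NormedAddCommGroup E] [InnerProductSpace ℝ E]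
    [FiniteDimensional ℝ E] {T : E →ₗ[ℝ] E} (hT : T.IsSymmetric) {μ : ℝ}
    (hμ : ∀ ν, Module.End.HasEigenvalue T ν → ν ≤ μ) (x : E) :
    inner ℝ x (T x) ≤ μ * ‖x‖ ^ 2 := by
  set b := hT.eigenvectorBasis rfl
  rw [← b.sum_inner_mul_inner, ← b.sum_sq_norm_inner_right x, Finset.mul_sum]
  refine Finset.sum_le_sum fun i _ => ?_
  have h1 : inner ℝ (b i) (T x) = hT.eigenvalues rfl i * inner ℝ (b i) x := by
    rw [← hT, hT.apply_eigenvectorBasis rfl i, real_inner_smul_left]; rfl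
  have h2 : hT.eigenvalues rfl i ≤ μ := hμ _ (hT.hasEigenvalue_eigenvalues rfl i)
  rw [h1, real_inner_comm, Real.norm_eq_abs, sq_abs]
  nlinarith [sq_nonneg (inner ℝ (b i) x)]

/-! ### From matrices to the abstract setting -/

section Spectral

variable {d : ℕ} {S : Matrix (Fin d) (Fin d) ℝ} {lam : Fin d → ℝ}
  {ustar : Fin d → EuclideanSpace ℝ (Fin d)}

/-- The eigenvectors as a sequence indexed by `ℕ`, continued by `0` after the last one. -/
noncomputable def eigVec (ustar : Fin d → EuclideanSpace ℝ (Fin d)) (k : ℕ) :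
    EuclideanSpace ℝ (Fin d) :=
  if h : k < d then ustar ⟨k, h⟩ else 0

theorem eigVec_of_lt {k : ℕ} (hk : k < d) : eigVec ustar k = ustar ⟨k, hk⟩ := dif_pos hk

theorem eig_of_lt {k : ℕ} (hk : k < d) : eig lam k = lam ⟨k, hk⟩ := dif_pos hk

theorem isSymmetric_toEuclideanLin {M : Matrix (Fin d) (Fin d) ℝ} (hM : M.IsSymm) :
    (Matrix.toEuclideanLin M).IsSymmetric :=
  Matrix.isSymmetric_toEuclideanLin_iff.mpr (by
    rw [Matrix.IsHermitian, Matrix.conjTranspose_eq_transpose_of_trivial]; exact hM)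

namespace SpectralAssumption

theorem eig_nonneg (hS : SpectralAssumption S lam ustar) (k : ℕ) : 0 ≤ eig lam k := by
  unfold eig
  split_ifs with hk
  · exact (hS.pos _).le
  · exact le_rfl

theorem eig_pos (hS : SpectralAssumption S lam ustar) {k : ℕ} (hk : k < d) : 0 < eig lam k := by
  rw [eig_of_lt hk]; exact hS.pos _

theorem eig_succ_lt (hS : SpectralAssumption S lam ustar) {k : ℕ} (hk : k < d) :
    eig lam (k + 1) < eig lam k := by
  by_cases hk' : k + 1 < d
  · rw [eig_of_lt hk, eig_of_lt hk']
    exact hS.anti (Fin.mk_lt_mk.mpr (Nat.lt_succ_self k))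
  · have : eig lam (k + 1) = 0 := dif_neg hk'
    rw [this]; exact hS.eig_pos hk

theorem antitone_eig (hS : SpectralAssumption S lam ustar) : Antitone (eig lam) := by
  refine antitone_nat_of_succ_le fun k => ?_
  by_cases hk : k < d
  · exact (hS.eig_succ_lt hk).le
  · have : eig lam (k + 1) = 0 := dif_neg (by omega)
    rw [this]; exact hS.eig_nonneg k

theorem eig_le_one (hS : SpectralAssumption S lam ustar) (k : ℕ) : eig lam k ≤ 1 := by
  by_cases hd : 0 < d
  · refine (hS.antitone_eig (Nat.zero_le k)).trans ?_
    rw [eig_of_lt hd, hS.top]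
  · have : eig lam k = 0 := dif_neg (by omega)
    rw [this]; exact zero_le_one

theorem orthonormal (hS : SpectralAssumption S lam ustar) : Orthonormal ℝ ustar := by
  refine ⟨hS.unit, fun i j hij => ?_⟩
  have h1 := isSymmetric_toEuclideanLin hS.symm (ustar i) (ustar j)
  rw [hS.eigen, hS.eigen, real_inner_smul_left, inner_smul_right] at h1
  have h2 : lam i - lam j ≠ 0 := sub_ne_zero.mpr (hS.anti.injective.ne hij)
  refine (mul_eq_zero.mp ?_).resolve_left h2
  linarith

theorem eigenSystem (hS : SpectralAssumption S lam ustar) :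
    EigenSystem (Matrix.toEuclideanLin S) d (eig lam) (eigVec ustar) where
  unit i hi := by rw [eigVec_of_lt hi, hS.unit]
  orth i hi j hj hij := by
    rw [eigVec_of_lt hi, eigVec_of_lt hj]
    exact hS.orthonormal.2 (by simpa using hij)
  eigen i hi := by rw [eigVec_of_lt hi, hS.eigen, eig_of_lt hi]
  symm := isSymmetric_toEuclideanLin hS.symm
  nonneg := hS.eig_nonneg
  contract m hm x hx := by
    -- Extending from all of `Fin d` adds nothing: `d` orthonormal vectors already form a basis. For
    -- `m = d` every coordinate vanishes, matching the value `0` of `eig` there.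
    obtain ⟨b, hb⟩ := Orthonormal.exists_orthonormalBasis_extension_of_card_eq
      (ι := Fin d) (by simp) (s := Set.univ)
      (hS.orthonormal.comp _ Subtype.val_injective)
    refine (pow_le_pow_iff_left₀ (norm_nonneg _)
      (mul_nonneg (hS.eig_nonneg m) (norm_nonneg _)) two_ne_zero).mp ?_
    rw [mul_pow, ← b.sum_sq_norm_inner_right, ← b.sum_sq_norm_inner_right x, Finset.mul_sum]
    refine Finset.sum_le_sum fun i _ => ?_
    have hbi := hb i (Set.mem_univ i)
    rw [hbi, ← isSymmetric_toEuclideanLin hS.symm, hS.eigen, real_inner_smul_left, norm_mul,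
      mul_pow]
    by_cases hi : i.1 < m
    · have := hx i.1 hi
      rw [eigVec_of_lt i.2] at this
      rw [this]
      simp
    · refine mul_le_mul_of_nonneg_right ?_ (by positivity)
      rw [Real.norm_eq_abs, abs_of_pos (hS.pos i)]
      refine pow_le_pow_left₀ (hS.pos i).le ?_ 2
      have := hS.antitone_eig (not_lt.mp hi)
      rwa [eig_of_lt i.2] at this

end SpectralAssumption

theorem toEuclideanLin_outer_mul_mul (v : EuclideanSpace ℝ (Fin d)) (M : Matrix (Fin d) (Fin d) ℝ)
    (x : EuclideanSpace ℝ (Fin d)) :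
    Matrix.toEuclideanLin (outer v * M * outer v) x =
      (inner ℝ v (Matrix.toEuclideanLin M v) * inner ℝ v x) • v := by
  ext i
  simp only [Matrix.ofLp_toLpLin, Matrix.toLin'_apply, ← Matrix.mulVec_mulVec, outer,
    Matrix.vecMulVec_mulVec, EuclideanSpace.inner_eq_star_dotProduct, star_trivial,
    Matrix.mulVec_smul, PiLp.smul_apply, Pi.smul_apply, MulOpposite.smul_eq_mul_unop,
    MulOpposite.unop_op, smul_eq_mul, dotProduct_comm]
  rw [dotProduct_comm (v.ofLp) x.ofLp]
  ring

theorem isSymm_deflMat (hS : S.IsSymm) (x₀ : ℕ → EuclideanSpace ℝ (Fin d)) (t k : ℕ) :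
    (deflMat S x₀ t k).IsSymm := by
  induction k with
  | zero => exact hS
  | succ k ih =>
    have ho : ∀ v : EuclideanSpace ℝ (Fin d), (outer v).transpose = outer v := fun v => by
      rw [outer, Matrix.transpose_vecMulVec]
    rw [Matrix.IsSymm, deflMat, Matrix.transpose_sub, Matrix.transpose_mul, Matrix.transpose_mul,
      ho, ih, Matrix.mul_assoc]

theorem deflationRun {K t : ℕ} (hS : SpectralAssumption S lam ustar) (hKd : K ≤ d)
    {x₀ u : ℕ → EuclideanSpace ℝ (Fin d)} {σ : ℕ → ℝ}
    (hunit : ∀ k < K, ‖u k‖ = 1)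
    (hσ : ∀ k < K, Matrix.toEuclideanLin (deflMat S x₀ t k) (u k) = σ k • u k)
    (htop : ∀ k < K, ∀ ν : ℝ,
      Module.End.HasEigenvalue (Matrix.toEuclideanLin (deflMat S x₀ t k)) ν → ν ≤ σ k)
    (hsign : ∀ (k : ℕ) (hk : k < K), 0 ≤ inner ℝ (u k) (ustar ⟨k, hk.trans_le hKd⟩)) :
    DeflationRun (Matrix.toEuclideanLin S) (eigVec ustar) K
      (fun k => Matrix.toEuclideanLin (deflMat S x₀ t k)) u (deflVec S x₀ t) σ where
  zero := rfl
  succ k x := by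
    simp only [deflMat, map_sub, LinearMap.sub_apply]
    rw [toEuclideanLin_outer_mul_mul]
    rfl
  symm k := isSymmetric_toEuclideanLin (isSymm_deflMat hS.symm x₀ t k)
  unit := hunit
  eigen := hσ
  top k hk := inner_map_le_of_eigenvalues_le
    (isSymmetric_toEuclideanLin (isSymm_deflMat hS.symm x₀ t k)) (htop k hk)
  sign k hk := by rw [eigVec_of_lt (hk.trans_le hKd)]; exact hsign k hk

theorem fastOrFar_deflVec {K t : ℕ} (hS : S.IsSymm)
    {x₀ u : ℕ → EuclideanSpace ℝ (Fin d)} {σ : ℕ → ℝ} {c₀ : ℝ} (hc₀ : 0 < c₀)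
    (hx₀ : ∀ k < K, ‖x₀ k‖ = 1) (hunit : ∀ k < K, ‖u k‖ = 1)
    (hσ : ∀ k < K, Matrix.toEuclideanLin (deflMat S x₀ t k) (u k) = σ k • u k)
    (hinit : ∀ k < K, c₀⁻¹ < |inner ℝ (x₀ k) (u k)|) :
    FastOrFar c₀ t K (fun k => Matrix.toEuclideanLin (deflMat S x₀ t k)) u (deflVec S x₀ t)
      σ := by
  intro k hk τ hσ0 hτ0 hτ
  obtain ⟨h1, -, h2⟩ := tangent_powerIteration_le
    (isSymmetric_toEuclideanLin (isSymm_deflMat hS x₀ t k)) (hunit k hk) (hσ k hk) hσ0 hτ0 hc₀ hτ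
    (x := powerIteration (deflMat S x₀ t k) (x₀ k)) (hx₀ k hk) (hinit k hk) (fun _ => rfl) t
  exact ⟨h1, fun hlt => norm_sub_le_of_tangent_le (hunit k hk) h1 hlt (by positivity) h2⟩

end Spectral

/-- Only `≤` holds in general: an iterate in the kernel of `M` is sent to `0`, because `0⁻¹ = 0`. -/
theorem norm_powerIteration_le {d : ℕ} (M : Matrix (Fin d) (Fin d) ℝ)
    {x : EuclideanSpace ℝ (Fin d)} (hx : ‖x‖ = 1) (t : ℕ) : ‖powerIteration M x t‖ ≤ 1 := by
  cases t with
  | zero => exact hx.le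
  | succ t =>
    rw [powerIteration, norm_smul, norm_inv, norm_norm]
    exact inv_mul_le_one

end InexactDeflation

/-! ### The main theorem -/

theorem theorem2 {d K : ℕ} (hK : 1 ≤ K) (hKd : K ≤ d)
    (S : Matrix (Fin d) (Fin d) ℝ) (lam : Fin d → ℝ)
    (ustar : Fin d → EuclideanSpace ℝ (Fin d))
    (hS : SpectralAssumption S lam ustar)
    (t : ℕ)
    -- the normalized initial vectors of the power iterations
    (x₀ : ℕ → EuclideanSpace ℝ (Fin d)) (hx₀ : ∀ k < K, ‖x₀ k‖ = 1)
    -- the top eigenvectors of the deflated matrices, with the sign convention `u_kᵀ u_k* ≥ 0`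
    (u : ℕ → EuclideanSpace ℝ (Fin d))
    (hu : ∀ k < K, IsTopEigenvector (deflMat S x₀ t k) (u k))
    (hsign : ∀ (k : ℕ) (hk : k < K), 0 ≤ inner ℝ (u k) (ustar ⟨k, hk.trans_le hKd⟩))
    (c₀ : ℝ) (hc₀ : 0 < c₀) (hinit : ∀ k < K, c₀⁻¹ < |inner ℝ (x₀ k) (u k)|)
    -- the conditions on the number `t` of steps
    (ht₁ : ∀ k < K, ∀ k' < k,
      Real.log (2 * growth c₀ lam k) *
        (Real.log ((eig lam (k' + 1) + 7 * eig lam k') /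
          (eig lam k' + 7 * eig lam (k' + 1))))⁻¹ ≤ (t : ℝ))
    (ht₂ : ∀ k : ℕ, k + 1 < d →
      1 / (Real.log (eig lam k) - Real.log (eig lam (k + 1))) ≤ (t : ℝ))
    (ht₃ : ∑ k' ∈ Finset.range (K - 1), (8 : ℝ) ^ (K - 1 - k') * (eig lam k' / gap lam k') *
        ((7 * eig lam (k' + 1) + eig lam k') / (7 * eig lam k' + eig lam (k' + 1))) ^ t
      ≤ minGap lam K hK / (140 * c₀)) :
    ∀ (k : ℕ) (hk : k < K),
      ‖deflVec S x₀ t k - ustar ⟨k, hk.trans_le hKd⟩‖ ≤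
        3 * ∑ k' ∈ Finset.range (k + 1), (8 : ℝ) ^ (k - k') * (eig lam k' / eig lam k) *
          (5 * ‖deflVec S x₀ t k' - u k'‖ +
            7 * c₀ / gap lam k' * (eig lam (k' + 1) / eig lam k') ^ t) := by
  intro k hk
  have hkd : k < d := hk.trans_le hKd
  have hterm : ∀ j ≤ k, (8 : ℝ) ^ (k - j) * (eig lam j / eig lam k) *
      (5 * ‖deflVec S x₀ t j - u j‖) ≤ (8 : ℝ) ^ (k - j) * (eig lam j / eig lam k) *
      (5 * ‖deflVec S x₀ t j - u j‖ +
        7 * c₀ / gap lam j * (eig lam (j + 1) / eig lam j) ^ t) := by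
    intro j hj
    have h1 : 0 < gap lam j := sub_pos.mpr (hS.eig_succ_lt (by omega))
    have h2 := hS.eig_nonneg j
    have h3 := hS.eig_nonneg (j + 1)
    have h4 := hS.eig_nonneg k
    have h5 : 0 ≤ 7 * c₀ / gap lam j * (eig lam (j + 1) / eig lam j) ^ t := by positivity
    exact mul_le_mul_of_nonneg_left (by linarith) (by positivity)
  have hterm0 : ∀ j ≤ k, 0 ≤ (8 : ℝ) ^ (k - j) * (eig lam j / eig lam k) *
      (5 * ‖deflVec S x₀ t j - u j‖) := by
    intro j _
    have h2 := hS.eig_nonneg j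
    have h4 := hS.eig_nonneg k
    positivity
  by_cases hfar : ∀ j ≤ k, ‖deflVec S x₀ t j - u j‖ < 1
  · choose! σ hσ using fun k hk => (hu k hk).2
    have hunit : ∀ k < K, ‖u k‖ = 1 := fun k hk => (hu k hk).1
    have hmain := mul_norm_sub_le_errAccum hS.eigenSystem hS.antitone_eig hKd
      (deflationRun hS hKd hunit (fun k hk => (hσ k hk).1) (fun k hk => (hσ k hk).2) hsign) hc₀
      (fun j hj => sub_pos.mpr (hS.eig_succ_lt (hj.trans_le hKd)))
      (fun j => by linarith [hS.eig_le_one j, hS.eig_nonneg (j + 1)])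
      (G := minGap lam K hK)
      (fun j hj => Finset.inf'_le (gap lam) (Finset.mem_range.mpr hj)) ht₃
      (fastOrFar_deflVec hS.symm hc₀ hx₀ hunit (fun k hk => (hσ k hk).1) hinit) hk hfar
    rw [eigVec_of_lt hkd, mul_comm, ← le_div_iff₀ (hS.eig_pos hkd), errAccum,
      Finset.sum_div] at hmain
    refine hmain.trans ?_
    rw [Finset.mul_sum]
    refine Finset.sum_le_sum fun j hj => ?_
    have hj : j ≤ k := Nat.lt_succ_iff.mp (Finset.mem_range.mp hj)
    refine le_trans ?_ (mul_le_mul_of_nonneg_left (hterm j hj) zero_le_three)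
    have h1 := hterm0 j hj
    -- Termwise, the induction beats the `5 * ‖δ_j‖` part of the claim by a factor 15.
    have h2 : (8 : ℝ) ^ (k + 1 - 1 - j) * (eig lam j * ‖deflVec S x₀ t j - u j‖) / eig lam k =
        1 / 5 * ((8 : ℝ) ^ (k - j) * (eig lam j / eig lam k) *
          (5 * ‖deflVec S x₀ t j - u j‖)) := by
      rw [Nat.add_sub_cancel]; ring
    rw [h2]
    linarith
  -- The weights are at least 1 because the eigenvalues decrease, so the summand at a far index `j`
  -- is at least 5 and the right-hand side at least 15, while the left-hand side is at most 2.
  · push Not at hfar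
    obtain ⟨j, hj, hfar⟩ := hfar
    have h1 : ‖deflVec S x₀ t k - ustar ⟨k, hkd⟩‖ ≤ 2 := by
      have h2 := norm_sub_le (deflVec S x₀ t k) (ustar ⟨k, hkd⟩)
      have h3 : ‖deflVec S x₀ t k‖ ≤ 1 := norm_powerIteration_le _ (hx₀ k hk) t
      rw [hS.unit] at h2
      linarith
    have h2 : 5 ≤ (8 : ℝ) ^ (k - j) * (eig lam j / eig lam k) *
        (5 * ‖deflVec S x₀ t j - u j‖) := by
      have h3 : (1 : ℝ) ≤ 8 ^ (k - j) := one_le_pow₀ (by norm_num)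
      have h4 : 1 ≤ eig lam j / eig lam k :=
        (one_le_div (hS.eig_pos hkd)).mpr (hS.antitone_eig hj)
      have h5 : 1 ≤ (8 : ℝ) ^ (k - j) * (eig lam j / eig lam k) :=
        one_le_mul_of_one_le_of_one_le h3 h4
      nlinarith
    have h3 := Finset.single_le_sum
      (f := fun j => (8 : ℝ) ^ (k - j) * (eig lam j / eig lam k) *
        (5 * ‖deflVec S x₀ t j - u j‖ +
          7 * c₀ / gap lam j * (eig lam (j + 1) / eig lam j) ^ t))
      (fun i hi => by
        have hi : i ≤ k := Nat.lt_succ_iff.mp (Finset.mem_range.mp hi)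
        exact (hterm0 i hi).trans (hterm i hi))
      (Finset.mem_range.mpr (Nat.lt_succ_iff.mpr hj))
    have h4 := hterm j hj
    linarith
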